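/- Let $d\ge 0$, let $H$ be a locally compact Hausdorff abelian group, written additively, and let $\Lambda\subseteq\mathbb R^d\times H$ be a subgroup such that the quotient $(\mathbb R^d\times H)/\Lambda$ is compact. Let $\pi:\mathbb R^d\times H\to\mathbb R^d$ and $\pi':\mathbb R^d\times H\to H$ be the projections, let $K\subseteq H$ be non-empty and relatively compact, and let $$\mathcal D_K=\{\pi(x) : x\in\Lambda,\ \pi'(x)\in K\}$$ be the model set with acceptance domain $K$. Assume that (i) the restriction of $\pi$ to $\Lambda$ is injective; (ii) the restriction of $\pi'$ to $\Lambda$ is injective; (iii) $G=\pi'(\Lambda)$ is dense in $H$; (iv) $K$ is the closure of its interior. Assume further that $H$ is connected and simply connected, and that $K$ contains an open path-connected set $V$ with $0\in V\subseteq K\subseteq\bigcup_{s\in V}(s+V)$. Then the universal group of the point-set semigroup $\Gamma(\mathcal D_K)$ is isomorphic to $G$. Here, for $\mathcal D\subseteq\mathbb R^d$, $\Gamma(\mathcal D)$ is the following set with a partial binary operation. Let $C(\mathcal D)$ be the set of triples $(p_2,P,p_1)$ with $P\subseteq\mathcal D$ finite and $p_1,p_2\in P$, with the partial product $(p_2,P,p_1)(q_2,Q,q_1)=(p_2,P\cup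 Q,q_1)$, defined if and only if $p_1=q_2$. For $g\in\mathbb R^d$ put $g\cdot(p_2,P,p_1)=(g+p_2,g+P,g+p_1)$, defined if and only if $g+P\subseteq\mathcal D$. Then $\Gamma(\mathcal D)$ is the set of classes $[x]$ of elements $x\in C(\mathcal D)$ under the equivalence relation $x\sim y$ if and only if $y=g\cdot x$ for some $g$, with the product $[x][y]=[(g\cdot x)(h\cdot y)]$, defined if and only if there are $g,h\in\mathbb R^d$ such that $(g\cdot x)(h\cdot y)$ is defined. The universal group of a set $S$ with a partial binary operation is the group generated by the set $S$ subject to the relations $s\cdot t=st$ for all $s,t\in S$ for which the product $st$ is defined in $S$. -/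

import Mathlib

open scoped Pointwise

/-- A set equipped with a partial binary operation: `pmul s t` is a partial value, whose domain
expresses that the product of `s` and `t` is defined. -/
class PartialMul (S : Type*) where
  pmul : S → S → Part S

/-- The universal group of a set with a partial binary operation: the free group on `S` modulo
the congruence generated by `(s) * (t) = (s ∘ t)`, for all `s`, `t` such that `s ∘ t` is
defined. -/
abbrev UniversalGroup (S : Type*) [PartialMul S] : Type _ :=
  PresentedGroup {r : FreeGroup S | ∃ s t u : S, u ∈ PartialMul.pmul s t ∧
    r = FreeGroup.of s * FreeGroup.of t * (FreeGroup.of u)⁻¹}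

/-- The category `C(D)` of a point-set `D`: the triples `(p₂, P, p₁)` with `P` a finite subset of
`D` and `p₁, p₂ ∈ P`. -/
@[ext]
structure PointedPattern {E : Type*} (D : Set E) where
  left : E
  pattern : Set E
  right : E
  finite : pattern.Finite
  subset : pattern ⊆ D
  left_mem : left ∈ pattern
  right_mem : right ∈ pattern

namespace PointedPattern

variable {E : Type*} {D : Set E}

/-- The partial product `(p₂, P, p₁) ∘ (q₂, Q, q₁) = (p₂, P ∪ Q, q₁)`, defined iff `p₁ = q₂`. -/
def comp (x y : PointedPattern D) : Part (PointedPattern D) where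
  Dom := x.right = y.left
  get _ :=
    { left := x.left
      pattern := x.pattern ∪ y.pattern
      right := y.right
      finite := x.finite.union y.finite
      subset := Set.union_subset x.subset y.subset
      left_mem := Or.inl x.left_mem
      right_mem := Or.inr y.right_mem }

theorem mem_comp_iff {x y z : PointedPattern D} :
    z ∈ comp x y ↔ x.right = y.left ∧
      z.left = x.left ∧ z.pattern = x.pattern ∪ y.pattern ∧ z.right = y.right := by
  constructor
  · rintro ⟨h, rfl⟩
    exact ⟨h, rfl, rfl, rfl⟩
  · rintro ⟨h, h₁, h₂, h₃⟩
    exact ⟨h, PointedPattern.ext h₁.symm h₂.symm h₃.symm⟩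

variable [AddCommGroup E]

/-- The partial action by translations: `g · (p₂, P, p₁) = (g + p₂, g + P, g + p₁)`, defined iff
`g + P ⊆ D`. -/
def translate (g : E) (x : PointedPattern D) : Part (PointedPattern D) where
  Dom := g +ᵥ x.pattern ⊆ D
  get h :=
    { left := g + x.left
      pattern := g +ᵥ x.pattern
      right := g + x.right
      finite := x.finite.vadd_set
      subset := h
      left_mem := Set.vadd_mem_vadd_set x.left_mem
      right_mem := Set.vadd_mem_vadd_set x.right_mem }

theorem mem_translate_iff {g : E} {x y : PointedPattern D} :
    y ∈ translate g x ↔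
      y.left = g + x.left ∧ y.pattern = g +ᵥ x.pattern ∧ y.right = g + x.right := by
  constructor
  · rintro ⟨h, rfl⟩
    exact ⟨rfl, rfl, rfl⟩
  · rintro ⟨h₁, h₂, h₃⟩
    exact ⟨by change g +ᵥ x.pattern ⊆ D; rw [← h₂]; exact y.subset,
      PointedPattern.ext h₁.symm h₂.symm h₃.symm⟩

/-- Two triples are equivalent iff one is a translate of the other. -/
def translateSetoid (D : Set E) : Setoid (PointedPattern D) where
  r x y := ∃ g : E, y ∈ translate g x
  iseqv :=
    { refl := fun x => ⟨0, mem_translate_iff.2 (by simp)⟩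
      symm := by
        rintro x y ⟨g, h⟩
        obtain ⟨h₁, h₂, h₃⟩ := mem_translate_iff.1 h
        exact ⟨-g, mem_translate_iff.2 (by simp [h₁, h₂, h₃])⟩
      trans := by
        rintro x y z ⟨g, h⟩ ⟨k, h'⟩
        obtain ⟨h₁, h₂, h₃⟩ := mem_translate_iff.1 h
        obtain ⟨k₁, k₂, k₃⟩ := mem_translate_iff.1 h'
        exact ⟨k + g, mem_translate_iff.2
          (by simp [h₁, h₂, h₃, k₁, k₂, k₃, add_assoc, add_vadd])⟩ }

end PointedPattern

/-- The point-set semigroup `Γ(D)` of a point-set `D`: the triples `(p₂, P, p₁)` up to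
translation. -/
def PointSetSemigroup {E : Type*} [AddCommGroup E] (D : Set E) : Type _ :=
  Quotient (PointedPattern.translateSetoid D)

namespace PointSetSemigroup

open PointedPattern

variable {E : Type*} [AddCommGroup E] {D : Set E}

/-- The class of a triple. -/
def mk (x : PointedPattern D) : PointSetSemigroup D :=
  Quotient.mk (translateSetoid D) x

theorem mk_eq_iff {x y : PointedPattern D} : mk x = mk y ↔ ∃ g : E, y ∈ translate g x :=
  Quotient.eq (r := translateSetoid D)

/-- `c` is a product of `a` and `b`: there are representatives `x` of `a` and `y` of `b` such that
`x ∘ y` is defined and represents `c`. -/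
def IsProd (a b c : PointSetSemigroup D) : Prop :=
  ∃ x y z : PointedPattern D, mk x = a ∧ mk y = b ∧ z ∈ comp x y ∧ mk z = c

/-- The product does not depend on the choice of composable representatives. -/
theorem IsProd.unique {a b c c' : PointSetSemigroup D} (h : IsProd a b c) (h' : IsProd a b c') :
    c = c' := by
  obtain ⟨x, y, z, hx, hy, hz, rfl⟩ := h
  obtain ⟨x', y', z', hx', hy', hz', rfl⟩ := h'
  obtain ⟨g, hg⟩ := mk_eq_iff.1 (hx.trans hx'.symm)
  obtain ⟨k, hk⟩ := mk_eq_iff.1 (hy.trans hy'.symm)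
  obtain ⟨g₁, g₂, g₃⟩ := mem_translate_iff.1 hg
  obtain ⟨k₁, k₂, k₃⟩ := mem_translate_iff.1 hk
  obtain ⟨e, z₁, z₂, z₃⟩ := mem_comp_iff.1 hz
  obtain ⟨e', z₁', z₂', z₃'⟩ := mem_comp_iff.1 hz'
  have hgk : g = k := by
    rw [g₃, k₁, e] at e'
    exact add_right_cancel e'
  subst hgk
  refine mk_eq_iff.2 ⟨g, mem_translate_iff.2 ⟨?_, ?_, ?_⟩⟩
  · rw [z₁', z₁, g₁]
  · rw [z₂', z₂, g₂, k₂, Set.vadd_set_union]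
  · rw [z₃', z₃, k₃]

/-- The partial product of `Γ(D)`: `[x][y] = [(g · x) ∘ (h · y)]`, defined iff there are
translations `g`, `h` such that `(g · x) ∘ (h · y)` is defined. -/
noncomputable instance : PartialMul (PointSetSemigroup D) where
  pmul a b := ⟨∃ c, IsProd a b c, fun h => h.choose⟩

theorem mem_pmul_iff {a b c : PointSetSemigroup D} :
    c ∈ PartialMul.pmul a b ↔ IsProd a b c := by
  constructor
  · rintro ⟨h, rfl⟩
    exact h.choose_spec
  · intro h
    exact ⟨⟨c, h⟩, IsProd.unique (Exists.choose_spec (⟨c, h⟩ : ∃ c, IsProd a b c)) h⟩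

end PointSetSemigroup

/-- The model set `{π(x) | x ∈ Λ, π'(x) ∈ K}` with acceptance domain `K`, where `π` and `π'` are
the projections of `E × H` onto its factors. -/
def modelSet {E H : Type*} [AddCommGroup E] [AddCommGroup H] (Λ : AddSubgroup (E × H))
    (K : Set H) : Set E :=
  {y | ∃ x ∈ Λ, x.2 ∈ K ∧ x.1 = y}

/-! In the universal group `U` the class of `(p₂, P, p₁)` does not depend on `P`, and translation
invariance leaves only `p₂ - p₁`. Lifting this difference to the lattice gives `diffHom : U → Λ`,
and `Λ ≅ G`. Conversely, `edgeZero` is a local homomorphism `f` from the lattice points over `V` to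
`U`, inverse to `diffHom` there; the covering hypothesis on `K` makes its values generate `U`
(`closure_edgeZero`). Surjectivity follows from connectedness of `H` and density
(`DenseRange.addSubgroup_eq_top`). Injectivity is a monodromy argument
(`IsMulLocalHom.injective_of_closure_eq_top`): `f` glues copies of `U` into a covering of `H`. Every
`u : U`, placed over the image of its lattice point, is joined by a path to the neutral point. If
`u` lies in the kernel, both points are in the fibre over `0`, and simple connectedness forces `u =
1`. -/

/-- Over a simply connected base, the endpoints of a path in the total space of a covering
agree as soon as they lie in the same fibre. -/
theorem IsCoveringMap.eq_of_joined {Z X : Type*} [TopologicalSpace Z] [TopologicalSpace X]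
    [SimplyConnectedSpace X] {p : Z → X} (cov : IsCoveringMap p) {e e' : Z} (h : Joined e e')
    (hp : p e = p e') : e = e' := by
  obtain ⟨γ⟩ := h
  have h1 := cov.monodromy_map (Path.Homotopic.Quotient.mk γ)
  -- With the endpoint a variable, `p e = x` can be substituted; the path class becomes a loop
  -- class, hence trivial.
  have key : ∀ (x : X) (hx : p e' = x) (q : Path.Homotopic.Quotient (p e) x),
      cov.monodromy q ⟨e, rfl⟩ = ⟨e', hx⟩ → p e = x → e = e' := by
    intro x hx q hq hpx
    subst hpx
    rw [Subsingleton.elim q (.refl (p e)), cov.monodromy_refl] at hq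
    exact congrArg Subtype.val hq
  exact key _ rfl _ h1 hp

/-- A homomorphism `ι` with dense range meets every open set around `h` in the form `h - W`. -/
theorem DenseRange.exists_sub_mem {A H : Type*} [AddCommGroup A] [AddCommGroup H]
    [TopologicalSpace H] [IsTopologicalAddGroup H] {ι : A →+ H} (hι : DenseRange ι) {W : Set H}
    (hW : IsOpen W) (h0 : 0 ∈ W) (h : H) : ∃ a, h - ι a ∈ W :=
  hι.exists_mem_open (hW.preimage (by fun_prop : Continuous fun k => h - k)) ⟨h, by simpa⟩

/-! ### The covering defined by a local homomorphism -/

section LocalHom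

variable {A H U : Type*} [AddCommGroup A] [AddCommGroup H] [Group U]

/-- `f` is multiplicative on the part of `A` that `ι` maps into `V`. -/
def IsMulLocalHom (ι : A →+ H) (V : Set H) (f : A → U) : Prop :=
  ∀ x y, ι x ∈ V → ι y ∈ V → ι (x + y) ∈ V → f (x + y) = f x * f y

theorem IsMulLocalHom.map_zero {ι : A →+ H} {V : Set H} {f : A → U} (hf : IsMulLocalHom ι V f)
    (h0 : 0 ∈ V) : f 0 = 1 := by
  have := hf 0 0 (by simpa) (by simpa) (by simpa)
  simpa using this

/-- The cocycle condition for the charts `ι a + W`: if three charts share a point, their centres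
differ by elements of `W - W ⊆ V`, where `f` is multiplicative. -/
theorem IsMulLocalHom.map_sub_mul {ι : A →+ H} {W V : Set H} {f : A → U} (hf : IsMulLocalHom ι V f)
    (hWV : W - W ⊆ V) {a b c : A} {h : H} (ha : h - ι a ∈ W) (hb : h - ι b ∈ W)
    (hc : h - ι c ∈ W) : f (c - b) * f (b - a) = f (c - a) := by
  have key : ∀ {a b : A}, h - ι a ∈ W → h - ι b ∈ W → ι (a - b) ∈ V := fun {a b} ha hb =>
    hWV ⟨_, hb, _, ha, by simp⟩
  have := hf (c - b) (b - a) (key hc hb) (key hb ha) (by simpa using key hc ha)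
  rw [← this, sub_add_sub_cancel]

variable [TopologicalSpace H] [IsTopologicalAddGroup H] [TopologicalSpace U] [DiscreteTopology U]

/-- The covering of `H` with fibre `U` whose charts are the translates `ι a + W`, for `a : A`, and
whose transition functions are the left multiplications by the values of the local
homomorphism `f`. -/
noncomputable def IsMulLocalHom.bundle {ι : A →+ H} {W V : Set H} {f : A → U}
    (hf : IsMulLocalHom ι V f) (hWV : W - W ⊆ V) (hι : DenseRange ι) (hW : IsOpen W) (h0 : 0 ∈ W) :
    FiberBundleCore A H U where
  baseSet a := {h | h - ι a ∈ W}
  isOpen_baseSet a := hW.preimage (by fun_prop)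
  indexAt h := (hι.exists_sub_mem hW h0 h).choose
  mem_baseSet_at h := (hι.exists_sub_mem hW h0 h).choose_spec
  coordChange a b _ u := f (b - a) * u
  coordChange_self a h hh u := by
    rw [sub_self, hf.map_zero (hWV ⟨0, h0, 0, h0, sub_zero 0⟩), one_mul]
  continuousOn_coordChange a b := by fun_prop
  coordChange_comp a b c h hh u := by
    rw [← mul_assoc, hf.map_sub_mul hWV hh.1.1 hh.1.2 hh.2]

namespace IsMulLocalHom

variable {ι : A →+ H} {W V : Set H} {f : A → U}
    (hf : IsMulLocalHom ι V f) (hWV : W - W ⊆ V) (hι : DenseRange ι) (hW : IsOpen W) (h0 : 0 ∈ W)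

/-- The point of the covering with coordinates `(h, u)` in the chart around `ι a`. -/
noncomputable def pt (a : A) (h : H) (u : U) : (hf.bundle hWV hι hW h0).TotalSpace :=
  ⟨h, f ((hf.bundle hWV hι hW h0).indexAt h - a) * u⟩

theorem pt_eq {a b : A} {h : H} (ha : h - ι a ∈ W) (hb : h - ι b ∈ W) (u : U) :
    hf.pt hWV hι hW h0 a h u = hf.pt hWV hι hW h0 b h (f (b - a) * u) := by
  have := hf.map_sub_mul hWV ha hb ((hf.bundle hWV hι hW h0).mem_baseSet_at h)
  rw [pt, pt, ← mul_assoc, this]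

theorem pt_injective (a : A) (h : H) :
    Function.Injective (hf.pt hWV hι hW h0 a h) := by
  intro u v huv
  exact mul_left_cancel (eq_of_heq (Bundle.TotalSpace.mk.inj huv).2)

theorem eq_pt (z : (hf.bundle hWV hι hW h0).TotalSpace) {a : A} (ha : z.1 - ι a ∈ W) :
    z = hf.pt hWV hι hW h0 a z.1 ((hf.bundle hWV hι hW h0).localTriv a z).2 :=
  (((hf.bundle hWV hι hW h0).localTriv a).toPartialEquiv.left_inv ha).symm

theorem continuousAt_pt {X : Type*} [TopologicalSpace X] {a : A} {h : X → H} {u : X → U} {x : X}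
    (ha : h x - ι a ∈ W) (hh : ContinuousAt h x) (hu : ContinuousAt u x) :
    ContinuousAt (fun x => hf.pt hWV hι hW h0 a (h x) (u x)) x := by
  have := ((hf.bundle hWV hι hW h0).localTriv a).toOpenPartialHomeomorph.continuousAt_symm
    (x := (h x, u x)) ((FiberBundleCore.mem_localTriv_target _ a _).2 ha)
  exact this.comp (f := fun x => (h x, u x)) (hh.prodMk hu)

/-- Translation of the covering by the point with coordinates `(ι x, u)` in the chart around
`ι x`. -/
noncomputable def translate (x : A) (u : U) (z : (hf.bundle hWV hι hW h0).TotalSpace) :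
    (hf.bundle hWV hι hW h0).TotalSpace :=
  hf.pt hWV hι hW h0 ((hf.bundle hWV hι hW h0).indexAt z.1 + x) (z.1 + ι x)
    ((show U from z.2) * u)

/-- Translation is independent of the chart: transition functions multiply on the left and depend
only on differences of centres, whereas translation multiplies on the right and shifts all centres
equally. -/
theorem translate_pt (x : A) (u : U) {a : A} {h : H} (ha : h - ι a ∈ W) (v : U) :
    hf.translate hWV hι hW h0 x u (hf.pt hWV hι hW h0 a h v) =
      hf.pt hWV hι hW h0 (a + x) (h + ι x) (v * u) := by
  rw [pt_eq hf hWV hι hW h0 (a := a + x) (b := (hf.bundle hWV hι hW h0).indexAt h + x)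
    (by simpa using ha)
    (by rw [map_add, add_sub_add_right_eq_sub]
        exact (hf.bundle hWV hι hW h0).mem_baseSet_at h), add_sub_add_right_eq_sub,
    ← mul_assoc]
  rfl

theorem continuous_translate (x : A) (u : U) :
    Continuous (hf.translate hWV hι hW h0 x u) := by
  refine continuous_iff_continuousAt.2 fun z => ?_
  let B := hf.bundle hWV hι hW h0
  let a := B.indexAt z.1
  have hz : z.1 - ι a ∈ W := B.mem_baseSet_at z.1
  have hcont : ContinuousAt (B.localTriv a) z :=
    (B.localTriv a).continuousAt ((B.mem_localTriv_source a z).2 hz)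
  have h1 : ContinuousAt (fun z' : B.TotalSpace => z'.1) z := B.continuous_proj.continuousAt
  have h2 : ContinuousAt (fun z' : B.TotalSpace => (B.localTriv a z').2) z :=
    continuous_snd.continuousAt.comp hcont
  have h3 : ContinuousAt (fun z' : B.TotalSpace => (B.localTriv a z').2 * u) z :=
    (continuous_of_discreteTopology (f := fun v : U => v * u)).continuousAt.comp h2
  refine (hf.continuousAt_pt hWV hι hW h0 (a := a + x) (h := fun z' => z'.1 + ι x)
    (by simpa using hz) (h1.add_const _) h3).congr (f := fun z' =>
      hf.pt hWV hι hW h0 (a + x) (z'.1 + ι x) ((B.localTriv a z').2 * u)) ?_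
  filter_upwards [h1 (((hf.bundle hWV hι hW h0).isOpen_baseSet a).mem_nhds hz)] with z' hz'
  conv_rhs => rw [hf.eq_pt hWV hι hW h0 z' hz']
  rw [translate_pt _ _ _ _ _ _ _ hz']

/-- In the covering, the point over `ι x` with coordinate `u` in the chart around `ι x` lies in the
path component of the neutral point. -/
def JoinedToOne (x : A) (u : U) : Prop :=
  Joined (hf.pt hWV hι hW h0 0 0 1) (hf.pt hWV hι hW h0 x (ι x) u)

variable {hf hWV hι hW h0}

/-- The path to `(x, u)`, translated by `(y, v)`, runs from `(y, v)` to `(x + y, u * v)`. -/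
theorem JoinedToOne.mul {x y : A} {u v : U} (hx : hf.JoinedToOne hWV hι hW h0 x u)
    (hy : hf.JoinedToOne hWV hι hW h0 y v) :
    hf.JoinedToOne hWV hι hW h0 (x + y) (u * v) := by
  have h := hx.map (hf.continuous_translate hWV hι hW h0 y v)
  rw [translate_pt _ _ _ _ _ _ _ (by simpa using h0),
    translate_pt _ _ _ _ _ _ _ (by simpa using h0)] at h
  simp only [zero_add, one_mul, ← map_add] at h
  exact hy.trans h

theorem JoinedToOne.inv {x : A} {u : U} (hx : hf.JoinedToOne hWV hι hW h0 x u) :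
    hf.JoinedToOne hWV hι hW h0 (-x) u⁻¹ := by
  have h := hx.map (hf.continuous_translate hWV hι hW h0 (-x) u⁻¹)
  rw [translate_pt _ _ _ _ _ _ _ (by simpa using h0),
    translate_pt _ _ _ _ _ _ _ (by simpa using h0)] at h
  simp only [zero_add, one_mul, ← map_add, add_neg_cancel, mul_inv_cancel] at h
  rw [JoinedToOne, ← _root_.map_zero ι]
  exact h.symm

theorem JoinedToOne.eq_one [SimplyConnectedSpace H] {u : U}
    (hu : hf.JoinedToOne hWV hι hW h0 0 u) : u = 1 := by
  have cov : IsCoveringMap (hf.bundle hWV hι hW h0).proj :=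
    FiberBundle.isCoveringMap (F := U) (E := (hf.bundle hWV hι hW h0).Fiber)
  have := cov.eq_of_joined hu (by simp [pt])
  rw [_root_.map_zero] at this
  exact (hf.pt_injective hWV hι hW h0 0 0 this).symm

/-- Over `V` the covering has a continuous section, equal to `f a` in any chart around `ι a ∈ V`; it
carries a path in `V` from `0` to `ι x` up to the covering. -/
theorem joinedToOne_of_mem (hV : IsOpen V) (hVp : IsPathConnected V) {x : A} (hx : ι x ∈ V) :
    hf.JoinedToOne hWV hι hW h0 x (f x) := by
  have hV0 : (0 : H) ∈ V := hWV ⟨0, h0, 0, h0, sub_zero 0⟩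
  have hex : ∀ h : H, h ∈ V → ∃ a, ι a ∈ V ∧ h - ι a ∈ W := fun h hh =>
    hι.exists_mem_open (s := V ∩ (fun k => h - k) ⁻¹' W)
      (hV.inter (hW.preimage (by fun_prop))) ⟨h, hh, by simpa⟩
  classical
  let c : H → A := fun h => if hh : h ∈ V then (hex h hh).choose else 0
  have hc : ∀ h ∈ V, ι (c h) ∈ V ∧ h - ι (c h) ∈ W := fun h hh => by
    simp only [c, dif_pos hh]
    exact (hex h hh).choose_spec
  have hpt : ∀ h a b, h - ι a ∈ W → h - ι b ∈ W → ι a ∈ V → ι b ∈ V →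
      hf.pt hWV hι hW h0 a h (f a) = hf.pt hWV hι hW h0 b h (f b) := by
    intro h a b ha hb ha' hb'
    rw [pt_eq hf hWV hι hW h0 ha hb, ← hf (b - a) a (hWV ⟨_, ha, _, hb, by simp⟩) ha' (by simpa),
      sub_add_cancel]
  have hs : ContinuousOn (fun h => hf.pt hWV hι hW h0 (c h) h (f (c h))) V := by
    intro h hh
    refine ContinuousAt.continuousWithinAt ?_
    refine (hf.continuousAt_pt hWV hι hW h0 (hc h hh).2 continuousAt_id
      (continuousAt_const (y := f (c h)))).congr ?_
    filter_upwards [hV.mem_nhds hh,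
      ((hf.bundle hWV hι hW h0).isOpen_baseSet (c h)).mem_nhds (hc h hh).2] with k hk hk'
    exact hpt k _ _ hk' (hc k hk).2 (hc h hh).1 (hc k hk).1
  have := ((hVp.joinedIn 0 hV0 (ι x) hx).map_continuousOn hs).joined
  rw [hpt 0 _ 0 (hc 0 hV0).2 (by simpa) (hc 0 hV0).1 (by simpa), hf.map_zero hV0,
    hpt (ι x) _ x (hc _ hx).2 (by simpa) (hc _ hx).1 hx] at this
  exact this

end IsMulLocalHom
end LocalHom

/-- Let `V` be a path-connected open neighbourhood of `0` in a simply connected group `H`. A group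
that is generated by the values on `V` of a local homomorphism `f` defined on a dense subgroup `A`
of `H` embeds into `A` by any homomorphism that is inverse to `f` on `V`. -/
theorem IsMulLocalHom.injective_of_closure_eq_top {A H U : Type*} [AddCommGroup A] [AddCommGroup H]
    [TopologicalSpace H] [IsTopologicalAddGroup H] [SimplyConnectedSpace H] [Group U]
    {ι : A →+ H} (hι : DenseRange ι) {V : Set H} (hV : IsOpen V) (hVp : IsPathConnected V)
    (hV0 : 0 ∈ V) {f : A → U} (hf : IsMulLocalHom ι V f)
    (hgen : Subgroup.closure (f '' (ι ⁻¹' V)) = ⊤) (p : U →* Multiplicative A)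
    (hp : ∀ x, ι x ∈ V → p (f x) = Multiplicative.ofAdd x) : Function.Injective p := by
  let : TopologicalSpace U := ⊥
  have : DiscreteTopology U := ⟨rfl⟩
  obtain ⟨W, hW, h0, hWV⟩ : ∃ W : Set H, IsOpen W ∧ 0 ∈ W ∧ W - W ⊆ V := by
    have : (fun q : H × H => q.1 - q.2) ⁻¹' V ∈ nhds ((0 : H), (0 : H)) :=
      (hV.preimage (by fun_prop)).mem_nhds (by simpa)
    rw [nhds_prod_eq, Filter.mem_prod_self_iff] at this
    obtain ⟨t, ht, htV⟩ := this
    obtain ⟨W, hWt, hW, h0⟩ := mem_nhds_iff.1 ht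
    refine ⟨W, hW, h0, ?_⟩
    rintro _ ⟨a, ha, b, hb, rfl⟩
    exact htV (show (a, b) ∈ t ×ˢ t from ⟨hWt ha, hWt hb⟩)
  have key : ∀ u : U, hf.JoinedToOne hWV hι hW h0 (p u).toAdd u := by
    intro u
    have hu : u ∈ Subgroup.closure (f '' (ι ⁻¹' V)) := hgen ▸ Subgroup.mem_top u
    induction hu using Subgroup.closure_induction with
    | mem u hu =>
      obtain ⟨x, hx, rfl⟩ := hu
      rw [hp x hx]
      exact joinedToOne_of_mem hV hVp hx
    | one =>
      rw [map_one, toAdd_one, JoinedToOne, _root_.map_zero]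
    | mul u v _ _ hu hv =>
      rw [map_mul, toAdd_mul]
      exact hu.mul hv
    | inv u _ hu =>
      rw [map_inv, toAdd_inv]
      exact hu.inv
  refine (injective_iff_map_eq_one p).2 fun u hu => ?_
  have := key u
  rw [hu] at this
  exact this.eq_one

/-! ### The universal group of a point-set semigroup -/

theorem UniversalGroup.of_mul_of {S : Type*} [PartialMul S] {s t u : S}
    (h : u ∈ PartialMul.pmul s t) :
    (PresentedGroup.of s * PresentedGroup.of t : UniversalGroup S) = PresentedGroup.of u :=
  PresentedGroup.mk_eq_mk_of_mul_inv_mem (x := FreeGroup.of s * FreeGroup.of t)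
    (y := FreeGroup.of u) ⟨s, t, u, h, rfl⟩

namespace PointSetSemigroup

open PointedPattern

variable {E : Type*} [AddCommGroup E] {D : Set E}

/-- The class of a triple in the universal group. -/
def toUniversalGroup (x : PointedPattern D) : UniversalGroup (PointSetSemigroup D) :=
  PresentedGroup.of (mk x)

theorem toUniversalGroup_mul {x y z : PointedPattern D} (h : z ∈ comp x y) :
    toUniversalGroup x * toUniversalGroup y = toUniversalGroup z :=
  UniversalGroup.of_mul_of (mem_pmul_iff.2 ⟨x, y, z, rfl, rfl, h, rfl⟩)

/-- Such a triple is idempotent. -/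
theorem toUniversalGroup_eq_one {x : PointedPattern D} (h : x.left = x.right) :
    toUniversalGroup x = 1 := by
  have := toUniversalGroup_mul (x := x) (y := x) (z := x) (mem_comp_iff.2 (by simp [h]))
  simpa using this

/-- The triple `(p, {p, q}, q)`. -/
@[simps]
def pair (p q : D) : PointedPattern D where
  left := p
  pattern := {(p : E), (q : E)}
  right := q
  finite := by simp
  subset := by simp [Set.insert_subset_iff]
  left_mem := by simp
  right_mem := by simp

/-- The image in the universal group of the class of `(p, {p, q}, q)`. -/
def edge (p q : D) : UniversalGroup (PointSetSemigroup D) :=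
  toUniversalGroup (pair p q)

theorem toUniversalGroup_eq_edge (x : PointedPattern D) :
    toUniversalGroup x = edge ⟨x.left, x.subset x.left_mem⟩ ⟨x.right, x.subset x.right_mem⟩ := by
  -- Multiplying by the idempotent `(p₁, P, p₁)` enlarges the pattern `{p₂, p₁}` to `P` without
  -- changing the value.
  let y : PointedPattern D := { x with left := x.right, left_mem := x.right_mem }
  have h : toUniversalGroup y = 1 := toUniversalGroup_eq_one rfl
  rw [← mul_one (edge _ _), ← h]
  let p : PointedPattern D := pair ⟨x.left, x.subset x.left_mem⟩ ⟨x.right, x.subset x.right_mem⟩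
  refine (toUniversalGroup_mul (x := p) (y := y) (z := x) (mem_comp_iff.2 ⟨rfl, rfl, ?_, rfl⟩)).symm
  refine (Set.union_eq_right.2 ?_).symm
  simp [p, y, Set.insert_subset_iff, x.left_mem, x.right_mem]

theorem edge_mul_edge (p q r : D) : edge p q * edge q r = edge p r := by
  obtain ⟨z, hz⟩ : ∃ z : PointedPattern D, z.left = p ∧ z.pattern = {(p : E), (q : E)} ∪
      {(q : E), (r : E)} ∧ z.right = r :=
    ⟨⟨p, {(p : E), (q : E)} ∪ {(q : E), (r : E)}, r, by simp, by simp [Set.insert_subset_iff],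
      by simp, by simp⟩, rfl, rfl, rfl⟩
  rw [edge, edge, toUniversalGroup_mul (mem_comp_iff.2 ⟨rfl, hz⟩), toUniversalGroup_eq_edge]
  congr 1
  · exact Subtype.ext hz.1
  · exact Subtype.ext hz.2.2

theorem edge_eq_of_sub_eq_sub {p q p' q' : D} (h : (p - q : E) = p' - q') :
    edge p q = edge p' q' := by
  refine congrArg PresentedGroup.of (mk_eq_iff.2 ⟨p' - p, mem_translate_iff.2 ⟨?_, ?_, ?_⟩⟩)
  · simp
  · have : (p' - p + q : E) = q' := by rw [sub_add, h, sub_sub_cancel]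
    simp [Set.vadd_set_insert, this]
  · change (q' : E) = p' - p + q
    rw [sub_add, h, sub_sub_cancel]

/-- The map `[p₂, P, p₁] ↦ ℓ (p₂ - p₁)`. -/
def diff {A : Type*} [AddCommGroup A] (ℓ : E → A) : PointSetSemigroup D → Multiplicative A :=
  Quotient.lift (fun x : PointedPattern D => Multiplicative.ofAdd (ℓ (x.left - x.right))) (by
    rintro x y ⟨g, hg⟩
    obtain ⟨h₁, -, h₃⟩ := mem_translate_iff.1 hg
    simp only [h₁, h₃, add_sub_add_left_eq_sub])

theorem diff_mk {A : Type*} [AddCommGroup A] (ℓ : E → A) (x : PointedPattern D) :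
    diff ℓ (mk x) = Multiplicative.ofAdd (ℓ (x.left - x.right)) := rfl

/-- The homomorphism `[p₂, P, p₁] ↦ ℓ (p₂ - p₁)` to a group `A`, for a map `ℓ` that is additive on
the differences of elements of `D`. -/
def diffHom {A : Type*} [AddCommGroup A] (ℓ : E → A)
    (hℓ : ∀ p ∈ D, ∀ q ∈ D, ∀ r ∈ D, ℓ (p - q) + ℓ (q - r) = ℓ (p - r)) :
    UniversalGroup (PointSetSemigroup D) →* Multiplicative A :=
  PresentedGroup.toGroup (f := diff ℓ) (by
    rintro _ ⟨_, _, _, h, rfl⟩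
    obtain ⟨x, y, z, rfl, rfl, hz, rfl⟩ := mem_pmul_iff.1 h
    obtain ⟨e, h₁, -, h₃⟩ := mem_comp_iff.1 hz
    have := hℓ _ (x.subset x.left_mem) _ (x.subset x.right_mem) _ (y.subset y.right_mem)
    simp only [map_mul, map_inv, FreeGroup.lift_apply_of, diff_mk, h₁, h₃]
    rw [← this, mul_inv_eq_one, ofAdd_add, e])

theorem diffHom_edge {A : Type*} [AddCommGroup A] {ℓ : E → A}
    (hℓ : ∀ p ∈ D, ∀ q ∈ D, ∀ r ∈ D, ℓ (p - q) + ℓ (q - r) = ℓ (p - r)) (p q : D) :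
    diffHom ℓ hℓ (edge p q) = Multiplicative.ofAdd (ℓ (p - q)) :=
  PresentedGroup.toGroup.of _

theorem closure_range_edge :
    Subgroup.closure (Set.range fun pq : D × D => edge pq.1 pq.2) = ⊤ := by
  rw [eq_top_iff, ← PresentedGroup.closure_range_of, Subgroup.closure_le]
  rintro _ ⟨s, rfl⟩
  obtain ⟨x, rfl⟩ := Quotient.exists_rep s
  exact Subgroup.subset_closure ⟨(_, _), (toUniversalGroup_eq_edge x).symm⟩

end PointSetSemigroup

/-! ### Generation of a dense subgroup near `0` -/

/-- In a connected group, a dense subgroup is generated by its elements in any neighbourhood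
of `0`. -/
theorem DenseRange.addSubgroup_eq_top {A H : Type*} [AddCommGroup A] [AddCommGroup H]
    [TopologicalSpace H] [IsTopologicalAddGroup H] [ConnectedSpace H] {ι : A →+ H}
    (hι : DenseRange ι) {V : Set H} (hV : IsOpen V) (hV0 : 0 ∈ V) {B : AddSubgroup A}
    (hB : ι ⁻¹' V ⊆ B) : B = ⊤ := by
  -- The closure of the image of `B` contains `V`, so it is an open and closed subgroup, hence all
  -- of `H`.
  have hVc : V ⊆ (B.map ι).topologicalClosure := by
    intro v hv
    refine mem_closure_iff.2 fun O hO hvO => ?_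
    obtain ⟨a, ha⟩ := hι.exists_mem_open (hO.inter hV) ⟨v, hvO, hv⟩
    exact ⟨ι a, ha.1, a, hB ha.2, rfl⟩
  have hopen : IsOpen ((B.map ι).topologicalClosure : Set H) :=
    AddSubgroup.isOpen_of_mem_nhds _ (g := 0) (Filter.mem_of_superset (hV.mem_nhds hV0) hVc)
  have htop : ((B.map ι).topologicalClosure : Set H) = Set.univ :=
    IsClopen.eq_univ ⟨AddSubgroup.isClosed_topologicalClosure _, hopen⟩ ⟨0, zero_mem _⟩
  refine eq_top_iff.2 fun a _ => ?_
  have ha : ι a ∈ closure (B.map ι : Set H) := by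
    have : ι a ∈ ((B.map ι).topologicalClosure : Set H) := htop ▸ Set.mem_univ _
    exact this
  obtain ⟨_, hb, b, hbB, rfl⟩ := mem_closure_iff.1 ha ((fun k => ι a - k) ⁻¹' V)
    (hV.preimage (by fun_prop)) (by simpa)
  have := B.add_mem (hB (show ι (a - b) ∈ V by simpa using hb)) hbB
  simpa using this

/-! ### Edges of model sets -/

namespace modelSet

open PointSetSemigroup

variable {E H : Type*} [AddCommGroup E] [AddCommGroup H] {Λ : AddSubgroup (E × H)} {K : Set H}

/-- The point of the model set below a lattice point. -/
def point (x : Λ) (hx : x.1.2 ∈ K) : modelSet Λ K := ⟨x.1.1, x.1, x.2, hx, rfl⟩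

theorem exists_eq_point (p : modelSet Λ K) : ∃ (x : Λ) (hx : x.1.2 ∈ K), p = point x hx := by
  obtain ⟨_, x, hx, hxK, rfl⟩ := p
  exact ⟨⟨x, hx⟩, hxK, rfl⟩

open Classical in
/-- The value of `[π x, {π x, 0}, 0]` in the universal group, for the lattice points `x` with
`π' x` in `V`. -/
noncomputable def edgeZero (Λ : AddSubgroup (E × H)) {K V : Set H} (hVK : V ⊆ K) (hV0 : 0 ∈ V)
    (x : Λ) : UniversalGroup (PointSetSemigroup (modelSet Λ K)) :=
  -- The value `1` is a mere default: only values over `V` matter.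
  if hx : x.1.2 ∈ V then edge (point x (hVK hx)) (point 0 (hVK hV0)) else 1

variable {V : Set H} (hVK : V ⊆ K) (hV0 : 0 ∈ V)

theorem edgeZero_of_mem {x : Λ} (hx : x.1.2 ∈ V) :
    edgeZero Λ hVK hV0 x = edge (point x (hVK hx)) (point 0 (hVK hV0)) :=
  dif_pos hx

theorem edge_point {x y : Λ} (hx : x.1.2 ∈ K) (hy : y.1.2 ∈ K) (hxy : (x - y).1.2 ∈ V) :
    edge (point x hx) (point y hy) = edgeZero Λ hVK hV0 (x - y) := by
  rw [edgeZero_of_mem hVK hV0 hxy]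
  exact edge_eq_of_sub_eq_sub (by simp [point])

/-- The edge from `x + y` to `0` factors through `y`, and its first factor is a translate of the
edge from `x` to `0`. -/
theorem isMulLocalHom_edgeZero :
    IsMulLocalHom ((AddMonoidHom.snd E H).comp Λ.subtype) V (edgeZero Λ hVK hV0) := by
  intro x y hx hy hxy
  have h := edge_point hVK hV0 (x := x + y) (hVK hxy) (hVK hy)
    (by rw [add_sub_cancel_right]; exact hx)
  rw [add_sub_cancel_right] at h
  rw [edgeZero_of_mem hVK hV0 hxy, edgeZero_of_mem hVK hV0 hy, ← h, edge_mul_edge]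

theorem closure_edgeZero [TopologicalSpace H] [IsTopologicalAddGroup H]
    (hι : DenseRange ((AddMonoidHom.snd E H).comp Λ.subtype)) (hV : IsOpen V)
    (hKV : K ⊆ ⋃ s ∈ V, s +ᵥ V) :
    Subgroup.closure (edgeZero Λ hVK hV0 '' ((AddMonoidHom.snd E H).comp Λ.subtype ⁻¹' V)) = ⊤ := by
  set C := Subgroup.closure (edgeZero Λ hVK hV0 '' ((AddMonoidHom.snd E H).comp Λ.subtype ⁻¹' V))
  have hmem : ∀ x : Λ, x.1.2 ∈ V → edgeZero Λ hVK hV0 x ∈ C := fun x hx =>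
    Subgroup.subset_closure ⟨x, hx, rfl⟩
  have hpt : ∀ p : modelSet Λ K, edge p (point 0 (hVK hV0)) ∈ C := by
    intro p
    obtain ⟨x, hx, rfl⟩ := exists_eq_point p
    obtain ⟨t, htV, v, hv, htv⟩ : ∃ t ∈ V, ∃ v ∈ V, t + v = x.1.2 := by
      simpa [Set.mem_add] using hKV hx
    -- Both `t` and `π' x - t` lie in the open set `V`, so by density a lattice point `s` can
    -- replace `t`; the edge from `x` to `0` then factors through `s`.
    obtain ⟨s, hs, hxs⟩ := hι.exists_mem_open (s := V ∩ (fun k => x.1.2 - k) ⁻¹' V)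
      (hV.inter (hV.preimage (by fun_prop))) ⟨t, htV, by simpa [← htv]⟩
    rw [← edge_mul_edge _ (point s (hVK hs)), edge_point hVK hV0 hx (hVK hs) hxs,
      ← edgeZero_of_mem hVK hV0 hs]
    exact C.mul_mem (hmem _ hxs) (hmem _ hs)
  rw [eq_top_iff, ← closure_range_edge, Subgroup.closure_le]
  rintro _ ⟨⟨p, q⟩, rfl⟩
  have h : edge p q = edge p (point 0 (hVK hV0)) * (edge q (point 0 (hVK hV0)))⁻¹ := by
    rw [eq_mul_inv_iff_mul_eq, edge_mul_edge]
  simp only [h]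
  exact C.mul_mem (hpt p) (C.inv_mem (hpt q))

end modelSet

open modelSet PointSetSemigroup

/-- The group `H` is written additively. -/
theorem theorem3p4p5 (d : ℕ) {H : Type*} [AddCommGroup H] [TopologicalSpace H]
    [IsTopologicalAddGroup H] [T2Space H] [LocallyCompactSpace H] [SimplyConnectedSpace H]
    (Λ : AddSubgroup (EuclideanSpace ℝ (Fin d) × H))
    (hΛ : CompactSpace ((EuclideanSpace ℝ (Fin d) × H) ⧸ Λ))
    (K : Set H) (hK_nonempty : K.Nonempty) (hK_bounded : IsCompact (closure K))
    (h_fst : Set.InjOn (fun x : EuclideanSpace ℝ (Fin d) × H => x.1) Λ)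
    (h_snd : Set.InjOn (fun x : EuclideanSpace ℝ (Fin d) × H => x.2) Λ)
    (G : AddSubgroup H) (hG : G = Λ.map (AddMonoidHom.snd (EuclideanSpace ℝ (Fin d)) H))
    (hG_dense : Dense (G : Set H))
    (hK : K = closure (interior K))
    (V : Set H) (hV_open : IsOpen V) (hV_path : IsPathConnected V) (hV_zero : 0 ∈ V)
    (hVK : V ⊆ K) (hKV : K ⊆ ⋃ s ∈ V, s +ᵥ V) :
    Nonempty (UniversalGroup (PointSetSemigroup (modelSet Λ K)) ≃* Multiplicative G) := by
  set ι : Λ →+ H := (AddMonoidHom.snd (EuclideanSpace ℝ (Fin d)) H).comp Λ.subtype with hι_def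
  have hrange : ι.range = G := by
    rw [hG, hι_def, AddMonoidHom.range_comp, AddSubgroup.range_subtype]
  have hι : DenseRange ι := by
    rw [DenseRange, ← AddMonoidHom.coe_range, hrange]
    exact hG_dense
  have hι_inj : Function.Injective ι := fun x y h => Subtype.ext (h_snd x.2 y.2 h)
  -- `ℓ` inverts `π` on `π(Λ)` and is arbitrary elsewhere, so additivity is claimed only for
  -- differences of points of the model set.
  let ℓ := Function.invFun fun x : Λ => x.1.1
  have hℓ : ∀ x : Λ, ℓ x.1.1 = x :=
    Function.leftInverse_invFun fun x y h => Subtype.ext (h_fst x.2 y.2 h)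
  have hℓ_sub : ∀ x y : Λ, ℓ (x.1.1 - y.1.1) = x - y := fun x y => hℓ (x - y)
  have hℓ_add : ∀ p ∈ modelSet Λ K, ∀ q ∈ modelSet Λ K, ∀ r ∈ modelSet Λ K,
      ℓ (p - q) + ℓ (q - r) = ℓ (p - r) := by
    rintro _ ⟨x, hx, -, rfl⟩ _ ⟨y, hy, -, rfl⟩ _ ⟨z, hz, -, rfl⟩
    rw [hℓ_sub ⟨x, hx⟩ ⟨y, hy⟩, hℓ_sub ⟨y, hy⟩ ⟨z, hz⟩, hℓ_sub ⟨x, hx⟩ ⟨z, hz⟩, sub_add_sub_cancel]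
  have hdiff : ∀ x : Λ, ι x ∈ V →
      diffHom ℓ hℓ_add (edgeZero Λ hVK hV_zero x) = Multiplicative.ofAdd x := by
    intro x hx
    rw [edgeZero_of_mem hVK hV_zero hx, diffHom_edge]
    exact congrArg _ ((hℓ_sub x 0).trans (sub_zero x))
  have hinj : Function.Injective (diffHom ℓ hℓ_add) :=
    (isMulLocalHom_edgeZero hVK hV_zero).injective_of_closure_eq_top hι hV_open hV_path hV_zero
      (closure_edgeZero hVK hV_zero hι hV_open hKV) _ hdiff
  have hsurj : Function.Surjective (diffHom ℓ hℓ_add) := by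
    have htop := hι.addSubgroup_eq_top hV_open hV_zero
      (B := Subgroup.toAddSubgroup' (diffHom ℓ hℓ_add).range) fun x hx => ⟨_, hdiff x hx⟩
    intro x
    exact (htop ▸ AddSubgroup.mem_top x.toAdd :
      x.toAdd ∈ Subgroup.toAddSubgroup' (diffHom ℓ hℓ_add).range)
  exact ⟨(MulEquiv.ofBijective _ ⟨hinj, hsurj⟩).trans (AddEquiv.toMultiplicative
    ((AddMonoidHom.ofInjective hι_inj).trans (AddEquiv.addSubgroupCongr hrange)))⟩
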